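/- Let $C$ be a finite set of symbols and $R$ a commutative ring. Fix a symmetric relation on $C$ of forbidden pairs such that every $i\in C$ has some $j\in C$ with $\{i,j\}$ not forbidden. Fix facial variables $x_i\in R$ and crossing variables $x_{ijkl}\in R$ with $x_{klij}=x_{ijkl}$, and with $x_{ijkl}=0$ if one of $\{i,j\},\{j,k\},\{k,l\},\{l,i\}$ is forbidden. The variable $x_{ijkl}$ belongs to a crossing viewed so that the overpass runs from south-west to north-east and the adjacent faces carry $i,j,k,l$ anticlockwise from the east. Suppose that the variables satisfy the following relations. * (Type 2) For all $w,e,s,n\in C$, put $P=\sum_k x_k\,x_{ekws}\,x_{nwke}$ and $Q=\sum_k x_k\,x_{kwse}\,x_{enwk}$. If $s\neq n$, then $P=Q=0$. If $s=n$ and neither $\{s,w\}$ nor $\{s,e\}$ is forbidden, then $x_sP=x_sQ=1$. * (Type 3) For every Reidemeister move of type 3 and all symbols of the six outer faces, the sums over the symbol $k$ of the central triangle of $x_k$ times the product of the three crossing variables agree on the two sides of the move. In particular every $x_i$ is invertible. Let $T$ be a diagram in the plane of a long link: one open strand with both ends going to infinity in opposite directions, together with finitely many closed components; the diagram may be disconnected,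 and it is given, as it can be up to planar isotopy, in general position with respect to the height function. Let $f$ and $g$ be its two infinite faces, in either order. For a face $F$ (a component of the complement of $T$ in the plane) let $\chi_F$ be its Euler characteristic. A state $\sigma$ assigns a symbol to each face, and is forbidden if two faces on the two sides of an edge carry a forbidden pair. For $i,j\in C$ put $$[T]_{ij}=\sum_\sigma\; x_i^{\chi_f-1}\,x_j^{\chi_g-1}\prod_{F\ne f,g}x_{\sigma(F)}^{\chi_F}\;\prod_{c}x_c(\sigma),$$ where $\sigma$ runs over the states that are not forbidden and satisfy $\sigma(f)=i$, $\sigma(g)=j$, and $x_c(\sigma)$ is the crossing variable at the crossing $c$. (If $T$ is connected, every $\chi_F$ is $1$; thus $f$ and $g$ contribute no facial variables and each other face $F$ contributes $x_{\sigma(F)}$.) Then for all $i,j,k,l\in C$: if $x_{iklj}$ or $x_{jikl}$ is invertible in $R$, then $[T]_{ij}=[T]_{kl}$. -/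

import Mathlib

namespace FaceStateSum

universe u v

/-- The variables of a facial state sum with symbols in `C` and values in `R`:
a list of forbidden pairs of symbols, a facial variable `x i` for every symbol, and a crossing
variable `X i j k l`.  The latter belongs to a crossing viewed so that the overpass runs from
south-west to north-east and the adjacent faces carry `i, j, k, l`, anticlockwise from the east.
Since links are unoriented, half a turn changes nothing; variables in which two faces with a
common edge carry a forbidden pair are zero. -/
structure StateVariables (C : Type u) (R : Type v) [CommRing R] where
  forbidden : C → C → Prop
  forbidden_symm : ∀ i j, forbidden i j → forbidden j i
  x : C → R
  X : C → C → C → C → R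
  X_half_turn : ∀ i j k l, X k l i j = X i j k l
  X_forbidden : ∀ i j k l,
    forbidden i j ∨ forbidden j k ∨ forbidden k l ∨ forbidden l i → X i j k l = 0

/-- The crossing variable of a crossing drawn with one strand from south-west to north-east and
the other from south-east to north-west, with symbols `w, s, e, n` in the west, south, east and
north faces.  If `pos = true` the overpass is the south-west to north-east strand, otherwise it
is the other strand (and one has to turn the picture by a right angle). -/
def StateVariables.cross {C : Type u} {R : Type v} [CommRing R] (V : StateVariables C R)
    (pos : Bool) (w s e n : C) : R :=
  if pos then V.X e n w s else V.X n w s e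

/-- The relations for the Reidemeister moves of types 2 and 3.

Type 2: two strands, running upwards, cross twice and form a digon.  The west and east faces are
marked `w` and `e`, the face below the first crossing `s`, the face above the second one `n`;
the digon and the last two faces merge in the move.

Type 3: three strands `a, b, c`, numbered from left to right at the bottom, cross pairwise.  The
hexagon of outer faces is marked `w` (left), `s₁, s₂` (bottom), `e` (right), `n₁, n₂` (top).
On one side the crossings are, from bottom to top, `ab, ac, bc`, on the other `bc, ac, ab`.
The flags `ab`, `ac`, `bc` say whether the first-named strand is the overpass; the condition
excludes precisely the two cases in which the strands cannot be ordered by height. -/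
structure StateVariables.ReidemeisterRelations {C : Type u} [Fintype C] {R : Type v} [CommRing R]
    (V : StateVariables C R) : Prop where
  type_two_ne : ∀ (pos : Bool) (w e s n : C), s ≠ n →
    ∑ k, V.x k * (V.cross pos w s e k * V.cross (!pos) w k e n) = 0
  type_two_eq : ∀ (pos : Bool) (w e s : C), ¬ V.forbidden s w → ¬ V.forbidden s e →
    V.x s * ∑ k, V.x k * (V.cross pos w s e k * V.cross (!pos) w k e s) = 1
  type_three : ∀ (ab ac bc : Bool), (ab = bc → ac = ab) → ∀ (w s₁ s₂ e n₁ n₂ : C),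
    ∑ k, V.x k * (V.cross ab w s₁ s₂ k * V.cross ac k s₂ e n₂ * V.cross bc w k n₂ n₁) =
    ∑ k, V.x k * (V.cross bc s₁ s₂ e k * V.cross ac w s₁ k n₁ * V.cross ab n₁ k e n₂)

/-- Facial variables are invertible, so that their negative powers below make sense. -/
theorem StateVariables.ReidemeisterRelations.isUnit_x {C : Type u} [Fintype C] {R : Type v}
    [CommRing R] {V : StateVariables C R} (hV : V.ReidemeisterRelations)
    (hne : ∀ i, ∃ j, ¬ V.forbidden i j) (i : C) : IsUnit (V.x i) := by
  obtain ⟨j, hj⟩ := hne i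
  exact IsUnit.of_mul_eq_one _ (hV.type_two_eq true j j i hj hj)

/-- Integral powers of an invertible element of a commutative ring. -/
noncomputable def intPow {R : Type v} [CommRing R] (a : R) : ℤ → R
  | Int.ofNat n => a ^ n
  | Int.negSucc n => (Ring.inverse a) ^ (n + 1)

/-- Elementary pieces of a plane diagram, inside a horizontal strip that `n` strands enter from
below and `n'` strands leave above: one local minimum, one local maximum, or one crossing, with
`m` vertical strands to its left.  In a crossing the flag tells whether the overpass is the
strand from south-west to north-east. -/
inductive Piece : ℕ → ℕ → Type
  | cup {n : ℕ} (m : Fin (n + 1)) : Piece n (n + 2)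
  | cap {n : ℕ} (m : Fin (n + 1)) : Piece (n + 2) n
  | crossing {n : ℕ} (m : Fin (n + 1)) (pos : Bool) : Piece (n + 2) (n + 2)

/-- A horizontal line that meets the diagram in `n` points is cut into the gaps `0, …, n`,
from left to right.  `P.Meets p q` says that gap `p` just below the piece and gap `q` just above
it meet along an interval of the level of the critical point or crossing.  (They meet along at
most one such interval.) -/
def Piece.Meets : {n n' : ℕ} → Piece n n' → Fin (n + 1) → Fin (n' + 1) → Prop
  | _, _, .cup m, p, q =>
      (q.val ≤ m.val ∧ q.val = p.val) ∨ (m.val + 2 ≤ q.val ∧ q.val = p.val + 2)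
  | _, _, .cap m, p, q =>
      (p.val ≤ m.val ∧ p.val = q.val) ∨ (m.val + 2 ≤ p.val ∧ p.val = q.val + 2)
  | _, _, .crossing m _, p, q => p.val = q.val ∧ p.val ≠ m.val + 1

/-- The crossing variable of a piece (1 if there is no crossing), for the symbols `c` in the gaps
below and `d` in the gaps above. -/
def Piece.factor {C : Type u} {R : Type v} [CommRing R] (V : StateVariables C R) :
    {n n' : ℕ} → Piece n n' → (Fin (n + 1) → C) → (Fin (n' + 1) → C) → R
  | _, _, .cup _, _, _ => 1
  | _, _, .cap _, _, _ => 1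
  | _, _, .crossing m pos, c, d =>
      V.cross pos (c ⟨m.val, by omega⟩) (c ⟨m.val + 1, by omega⟩) (c ⟨m.val + 2, by omega⟩)
        (d ⟨m.val + 1, by omega⟩)

/-- A diagram of a long link in the plane, in general position with respect to height: horizontal
layers without critical points and crossings, where layer `t` contains `width t` vertical
strands, alternate with elementary pieces.  A single strand comes from infinity below and a single
strand goes to infinity above; they belong to the only open component, but there may be any
number of closed components, and the diagram need not be connected. -/
structure LongLink where
  height : ℕ
  width : Fin (height + 1) → ℕ
  width_bottom : width 0 = 1
  width_top : width (Fin.last height) = 1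
  piece : (t : Fin height) → Piece (width t.castSucc) (width t.succ)

namespace LongLink

variable (T : LongLink)

/-- The connected components of the complement of the diagram in the layers. -/
abbrev Cell : Type := Σ t : Fin (T.height + 1), Fin (T.width t + 1)

/-- The connected components of the complement of the diagram in the levels of critical points
and crossings: each is an interval in which a gap below meets a gap above. -/
abbrev Joint : Type :=
  {J : Σ t : Fin T.height, Fin (T.width t.castSucc + 1) × Fin (T.width t.succ + 1) //
    (T.piece J.1).Meets J.2.1 J.2.2}

def Joint.lower {T : LongLink} (J : T.Joint) : T.Cell := ⟨J.1.1.castSucc, J.1.2.1⟩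

def Joint.upper {T : LongLink} (J : T.Joint) : T.Cell := ⟨J.1.1.succ, J.1.2.2⟩

/-- A face is a connected component of the complement of the diagram in the plane: cells are glued
along joints. -/
def Face : Type := Quot (fun c d : T.Cell => ∃ J : T.Joint, J.lower = c ∧ J.upper = d)

/-- The face that contains gap `p` of layer `t`. -/
def face (t : Fin (T.height + 1)) (p : Fin (T.width t + 1)) : T.Face := Quot.mk _ ⟨t, p⟩

instance : Finite T.Face := Finite.of_surjective (Quot.mk _) Quot.mk_surjective

noncomputable instance : Fintype T.Face := Fintype.ofFinite _

/-- The Euler characteristic of a face: its cells are contractible and are glued along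
contractible joints. -/
noncomputable def eulerChar (F : T.Face) : ℤ :=
  (Nat.card {c : T.Cell // T.face c.1 c.2 = F} : ℤ) -
    (Nat.card {J : T.Joint // T.face J.lower.1 J.lower.2 = F} : ℤ)

/-- The infinite face to the left of the open component. -/
def leftFace : T.Face := T.face 0 0

/-- The infinite face to the right of the open component. -/
def rightFace : T.Face := T.face 0 (Fin.last _)

def infiniteFaces : Set T.Face := {T.leftFace, T.rightFace}

/-- A state is forbidden if two faces on the two sides of an edge carry a forbidden pair. -/
def Forbidden {C : Type u} {R : Type v} [CommRing R] (V : StateVariables C R)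
    (σ : T.Face → C) : Prop :=
  ∃ (t : Fin (T.height + 1)) (p : Fin (T.width t)),
    V.forbidden (σ (T.face t p.castSucc)) (σ (T.face t p.succ))

/-- A partial state assigns zero or more symbols to every face. -/
abbrev PartialState (C : Type u) : Type u := T.Face → Set C

def Extends {T : LongLink} {C : Type u} (σ : T.Face → C) (π : T.PartialState C) : Prop :=
  ∀ F, ∀ c ∈ π F, σ F = c

open Classical in
/-- The value of a partial state: the sum over all states that extend it and are not forbidden.
A face with symbol `i` contributes `x i` to the power of its Euler characteristic, and every
crossing contributes its crossing variable.  For a face to which the partial state assigns the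
symbol `i`, the factor `x i` of a disk is not counted; so such a face contributes 1 if it is a
disk, and only its holes (which exist for disconnected diagrams only) are still accounted for.
This makes the value equal to that of a diagram in which all faces are disks, obtained from
the given one by moves of type 2. -/
noncomputable def value {C : Type u} [Fintype C] {R : Type v} [CommRing R]
    (V : StateVariables C R) (π : T.PartialState C) : R :=
  ∑ σ : T.Face → C, if Extends σ π ∧ ¬ T.Forbidden V σ then
      (∏ F : T.Face, intPow (V.x (σ F))
          (if π F = ∅ then T.eulerChar F else T.eulerChar F - 1)) *
        ∏ t : Fin T.height, (T.piece t).factor V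
          (fun p => σ (T.face t.castSucc p)) (fun q => σ (T.face t.succ q))
    else 0

/-- The partial state that assigns `i` to `f` and `j` to `g`, and nothing to other faces. -/
def twoFaces {T : LongLink} {C : Type u} (f g : T.Face) (i j : C) : T.PartialState C :=
  fun F => {c | (F = f ∧ c = i) ∨ (F = g ∧ c = j)}

end LongLink

end FaceStateSum

/-! Draw a horizontal strand above `T`, passing entirely over it or entirely under it, and pull it
down until it lies below `T`. The strand passes each local extremum by a move of type 2 and each
crossing by a move of type 3, so the state sum does not change. Before the pull the infinite faces
beside `T` carry `i, j`, and the strand meets only the upper end of the open component, in a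
crossing with symbols `i, j` below and `k, l` above. After the pull the faces beside `T` carry `k,
l`, and the same crossing sits at the lower end. Hence `[T]_{ij} * B = B * [T]_{kl}`, where `B` is
that crossing variable, and an invertible `B` cancels.

The code uses transfer matrices. A state becomes a path of colourings of the layers, and its weight
becomes a product over layers and pieces, because the Euler characteristic of a face is its number
of cells minus its number of joints. `ReidemeisterRelations.sum_weight_strip` lets the strand pass
one piece, and `sum_pathSum_mul` iterates this over the height. The matrix of the whole of `T` is
diagonal, since the bottom and top layers see the same two infinite faces (`boundaryValue_eq_zero`).
Its diagonal entries are the values `[T]_{ij}` (`value_eq_boundaryValue`), and `value_mul_strand`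
combines these facts. -/

namespace FaceStateSum

universe u v

open Finset

/-! ### Colourings of the gaps of one layer -/

section Gaps

variable {C : Type u} {n : ℕ}

/-- The symbol of gap `p`, where gaps beyond the last one repeat it. -/
def gap (c : Fin (n + 1) → C) (p : ℕ) : C := c ⟨min p n, by omega⟩

theorem gap_of_le (c : Fin (n + 1) → C) {p : ℕ} (hp : p ≤ n) : gap c p = c ⟨p, by omega⟩ := by
  simp [gap, hp]

theorem gap_val (c : Fin (n + 1) → C) (p : Fin (n + 1)) : gap c p.val = c p :=
  gap_of_le c (by omega)

theorem ext_gap {c d : Fin (n + 1) → C} (h : ∀ p ≤ n, gap c p = gap d p) : c = d := by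
  funext p
  rw [← gap_val c, ← gap_val d, h _ (by omega)]

/-- A new gap with symbol `k` splits gap `m`. -/
def splitGap (m : Fin (n + 1)) (k : C) (c : Fin (n + 1) → C) : Fin (n + 2 + 1) → C := fun q =>
  if q.val ≤ m.val then gap c q.val else if q.val = m.val + 1 then k else gap c (q.val - 2)

/-- Gaps `m, m + 1, m + 2` are replaced by gap `m`. -/
def mergeGap (m : Fin (n + 1)) (e : Fin (n + 2 + 1) → C) : Fin (n + 1) → C := fun q =>
  if q.val ≤ m.val then gap e q.val else gap e (q.val + 2)

/-- Gap `m + 1` gets the symbol `k`. -/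
def setGap (m : Fin (n + 1)) (k : C) (c : Fin (n + 2 + 1) → C) : Fin (n + 2 + 1) → C := fun q =>
  if q.val = m.val + 1 then k else c q

theorem gap_splitGap (m : Fin (n + 1)) (k : C) (c : Fin (n + 1) → C) (q : ℕ) :
    gap (splitGap m k c) q =
      if q ≤ m.val then gap c q else if q = m.val + 1 then k else gap c (q - 2) := by
  have := m.isLt
  rcases le_or_gt q (n + 2) with h | h
  · rw [gap_of_le _ h]; rfl
  · have h1 : min q (n + 2) = n + 2 := by omega
    have h2 : min (n + 2 - 2) n = min (q - 2) n := by omega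
    rw [if_neg (by omega), if_neg (by omega)]
    simp only [gap, splitGap, h1]
    rw [if_neg (by omega), if_neg (by omega)]
    simp only [h2]

theorem gap_mergeGap (m : Fin (n + 1)) (e : Fin (n + 2 + 1) → C) {q : ℕ} (hq : q ≤ n) :
    gap (mergeGap m e) q = if q ≤ m.val then gap e q else gap e (q + 2) := by
  rw [gap_of_le _ hq]; rfl

theorem gap_setGap (m : Fin (n + 1)) (k : C) (c : Fin (n + 2 + 1) → C) {q : ℕ} (hq : q ≤ n + 2) :
    gap (setGap m k c) q = if q = m.val + 1 then k else gap c q := by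
  rw [gap_of_le _ hq, gap_of_le _ hq]; rfl

/-- Used in both directions at a local extremum: the wide layer is determined by the narrow one and
`k`, and the narrow layer is determined by the wide one. -/
theorem eq_splitGap_iff (m : Fin (n + 1)) (c : Fin (n + 1) → C) (e : Fin (n + 2 + 1) → C) (k : C) :
    e = splitGap m k c ↔
      gap e (m.val + 1) = k ∧ gap e m.val = gap e (m.val + 2) ∧ c = mergeGap m e := by
  have := m.isLt
  constructor
  · rintro rfl
    refine ⟨by simp [gap_splitGap], by simp [gap_splitGap], ext_gap fun p hp => ?_⟩
    rw [gap_mergeGap _ _ hp]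
    simp only [gap_splitGap]
    split_ifs <;> first | rfl | omega
  · rintro ⟨rfl, h, rfl⟩
    refine ext_gap fun p hp => ?_
    rw [gap_splitGap]
    split_ifs with h1 h2
    · rw [gap_mergeGap _ _ (by omega), if_pos h1]
    · rw [h2]
    · rw [gap_mergeGap _ _ (by omega)]
      split_ifs with h3
      · have h4 : p = m.val + 2 := by omega
        subst h4
        simpa using h.symm
      · congr 1; omega

theorem prod_range_split {M : Type*} [CommMonoid M] {m n j : ℕ} (h : m ≤ n) (f : ℕ → M) :
    ∏ p ∈ range (n + j), f p =
      (∏ p ∈ range m, f p) * (∏ p ∈ range j, f (m + p)) * ∏ p ∈ range (n - m), f (m + j + p) := by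
  obtain ⟨r, rfl⟩ := Nat.exists_eq_add_of_le h
  rw [show m + r + j = m + j + r by omega, prod_range_add, prod_range_add, Nat.add_sub_cancel_left]

end Gaps

/-! ### A horizontal strand across a layer -/

section Strip

variable {C : Type u} {R : Type v} [CommRing R] {n : ℕ}

/-- The weight of a horizontal strand that crosses `n` vertical strands, whose crossings have
weights given by `B`, for the symbols `c` below and `d` above the strand. -/
def stripWeight (B : C → C → C → C → R) (c d : Fin (n + 1) → C) : R :=
  ∏ p ∈ range n, B (gap c p) (gap c (p + 1)) (gap d p) (gap d (p + 1))

/-- No two adjacent gaps carry a forbidden pair. -/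
def Admissible (forb : C → C → Prop) (c : Fin (n + 1) → C) : Prop :=
  ∀ p < n, ¬ forb (gap c p) (gap c (p + 1))

theorem Admissible.of_splitGap {forb : C → C → Prop} {m : Fin (n + 1)} {k : C}
    {c : Fin (n + 1) → C} (h : Admissible forb (splitGap m k c)) : Admissible forb c := by
  intro p hp
  rcases lt_or_ge p m.val with h1 | h1
  · have := h p (by omega)
    rwa [gap_splitGap, gap_splitGap, if_pos (by omega), if_pos (by omega)] at this
  · have := h (p + 2) (by omega)
    rwa [gap_splitGap, gap_splitGap, if_neg (by omega), if_neg (by omega), if_neg (by omega),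
      if_neg (by omega), Nat.add_sub_cancel, show p + 2 + 1 - 2 = p + 1 by omega] at this

theorem Admissible.splitGap {forb : C → C → Prop} (hsymm : ∀ i j, forb i j → forb j i)
    {m : Fin (n + 1)} {k : C} {c : Fin (n + 1) → C} (h : Admissible forb c)
    (hk : ¬ forb (gap c m.val) k) : Admissible forb (splitGap m k c) := by
  intro p hp
  rw [gap_splitGap, gap_splitGap]
  rcases lt_trichotomy p m.val with h1 | h1 | h1
  · rw [if_pos (by omega), if_pos (by omega)]; exact h p (by omega)
  · subst h1
    rw [if_pos le_rfl, if_neg (by omega), if_pos rfl]; exact hk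
  · rcases eq_or_ne p (m.val + 1) with rfl | h2
    · rw [if_neg (by omega), if_pos rfl, if_neg (by omega), if_neg (by omega)]
      exact fun h3 => hk (hsymm _ _ h3)
    · rw [if_neg (by omega), if_neg h2, if_neg (by omega), if_neg (by omega)]
      have := h (p - 2) (by omega)
      rwa [show p - 2 + 1 = p + 1 - 2 by omega] at this

/-- Crossing weights `B a a' b b'`, with `a, a'` below and `b, b'` above the horizontal strand,
that vanish when adjacent faces carry a forbidden pair. -/
def VanishesOn (forb : C → C → Prop) (B : C → C → C → C → R) : Prop :=
  ∀ a a' b b', forb a a' ∨ forb b b' ∨ forb a b ∨ forb a' b' → B a a' b b' = 0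

theorem VanishesOn.flip {forb : C → C → Prop} (hsymm : ∀ i j, forb i j → forb j i)
    {B : C → C → C → C → R} (hB : VanishesOn forb B) :
    VanishesOn forb (fun a a' b b' => B b b' a a') := by
  intro a a' b b' h
  refine hB _ _ _ _ ?_
  rcases h with h | h | h | h
  · exact Or.inr (Or.inl h)
  · exact Or.inl h
  · exact Or.inr (Or.inr (Or.inl (hsymm _ _ h)))
  · exact Or.inr (Or.inr (Or.inr (hsymm _ _ h)))

variable {forb : C → C → Prop} {B : C → C → C → C → R} (hB : VanishesOn forb B)
include hB

theorem VanishesOn.admissible_of_ne_zero {c d : Fin (n + 1) → C} (h : stripWeight B c d ≠ 0) :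
    Admissible forb c ∧ Admissible forb d := by
  constructor <;> intro p hp hf <;>
    refine h (prod_eq_zero (mem_range.2 hp) (hB _ _ _ _ ?_))
  · exact Or.inl hf
  · exact Or.inr (Or.inl hf)

/-- Every gap borders a crossing of the strand once there is at least one vertical strand. For `n =
0` the weight is an empty product and detects nothing. -/
theorem VanishesOn.not_forb_of_ne_zero (hn : n ≠ 0) {c d : Fin (n + 1) → C}
    (h : stripWeight B c d ≠ 0) {p : ℕ} (hp : p ≤ n) : ¬ forb (gap c p) (gap d p) := by
  intro hf
  rcases lt_or_ge p n with h1 | h1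
  · exact h (prod_eq_zero (mem_range.2 h1) (hB _ _ _ _ (Or.inr (Or.inr (Or.inl hf)))))
  · obtain ⟨q, rfl⟩ : ∃ q, p = q + 1 := ⟨p - 1, by omega⟩
    exact h (prod_eq_zero (mem_range.2 (by omega : q < n))
      (hB _ _ _ _ (Or.inr (Or.inr (Or.inr hf)))))

end Strip

/-! ### Pulling a strand past a local extremum -/

section TypeTwo

variable {C : Type u} [Fintype C] {R : Type v} [CommRing R] {n : ℕ}

open Classical in
/-- The relation for a move of type 2 that pulls a local minimum through a horizontal strand. -/
def PullsThrough (forb : C → C → Prop) (u : C → Rˣ) (B : C → C → C → C → R) : Prop :=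
  ∀ a p q r, ∑ k, (u k : R) * (B a k p q * B k a q r) =
    if p = r ∧ ¬ forb a p ∧ ¬ forb p q then (↑(u p)⁻¹ : R) else 0

-- Only the two crossings of the strand with the legs of the minimum depend on `k`. The type 2
-- relation evaluates their sum, and the remaining crossings form the strip over the merged layer.
open Classical in
theorem PullsThrough.sum_splitGap {forb : C → C → Prop} {u : C → Rˣ}
    {B : C → C → C → C → R} (hsymm : ∀ i j, forb i j → forb j i) (hB : VanishesOn forb B)
    (h : PullsThrough forb u B) (hn : n ≠ 0) (m : Fin (n + 1)) (c : Fin (n + 1) → C)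
    (e : Fin (n + 2 + 1) → C) :
    ∑ k, (u k : R) * stripWeight B (splitGap m k c) e =
      if gap e m.val = gap e (m.val + 2) ∧ Admissible forb e then
        (↑(u (gap e m.val))⁻¹ : R) * stripWeight B c (mergeGap m e) else 0 := by
  have hm := m.isLt
  have hmn : m.val ≤ n := by omega
  set pre : R := ∏ p ∈ range m.val, B (gap c p) (gap c (p + 1)) (gap e p) (gap e (p + 1)) with hpre
  set post : R := ∏ p ∈ range (n - m.val), B (gap c (m.val + p)) (gap c (m.val + p + 1))
    (gap e (m.val + 2 + p)) (gap e (m.val + 2 + p + 1)) with hpost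
  have h1 : ∀ k, stripWeight B (splitGap m k c) e = pre * (B (gap c m.val) k (gap e m.val)
      (gap e (m.val + 1)) * B k (gap c m.val) (gap e (m.val + 1)) (gap e (m.val + 2))) * post := by
    intro k
    rw [stripWeight, prod_range_split hmn]
    congr 1
    · congr 1
      · refine prod_congr rfl fun p hp => ?_
        rw [mem_range] at hp
        rw [gap_splitGap, gap_splitGap, if_pos (by omega), if_pos (by omega)]
      · simp [prod_range_succ, gap_splitGap, add_assoc]
    · refine prod_congr rfl fun p hp => ?_
      rw [gap_splitGap, gap_splitGap, if_neg (by omega), if_neg (by omega), if_neg (by omega),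
        if_neg (by omega), show m.val + 2 + p - 2 = m.val + p by omega,
        show m.val + 2 + p + 1 - 2 = m.val + p + 1 by omega]
  have h2 : ∑ k, (u k : R) * stripWeight B (splitGap m k c) e = pre * post *
      if gap e m.val = gap e (m.val + 2) ∧ ¬ forb (gap c m.val) (gap e m.val) ∧
        ¬ forb (gap e m.val) (gap e (m.val + 1)) then (↑(u (gap e m.val))⁻¹ : R) else 0 := by
    rw [← h, mul_sum]
    refine sum_congr rfl fun k _ => ?_
    rw [h1]; ring
  rw [h2]
  by_cases he : gap e m.val = gap e (m.val + 2)
  swap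
  · rw [if_neg (fun h => he h.1), if_neg (fun h => he h.1), mul_zero]
  have h3 : stripWeight B c (mergeGap m e) = pre * post := by
    -- The middle block is empty here, because the two crossings with the legs are gone.
    have h0 := prod_range_split (j := 0) hmn
      (fun p => B (gap c p) (gap c (p + 1)) (gap (mergeGap m e) p) (gap (mergeGap m e) (p + 1)))
    simp only [add_zero, range_zero, prod_empty, mul_one] at h0
    rw [stripWeight, h0]
    congr 1
    · refine prod_congr rfl fun p hp => ?_
      rw [mem_range] at hp
      rw [gap_mergeGap _ _ (by omega), gap_mergeGap _ _ (by omega), if_pos (by omega),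
        if_pos (by omega)]
    · refine prod_congr rfl fun p hp => ?_
      rw [mem_range] at hp
      rw [gap_mergeGap _ _ (by omega), gap_mergeGap _ _ (by omega),
        if_neg (by omega : ¬ m.val + p + 1 ≤ m.val)]
      -- At `p = 0` the merged gap carries the symbol of gap `m`, which `he` identifies with that of
      -- gap `m + 2`.
      rcases eq_or_ne p 0 with rfl | h4
      · simp only [add_zero, le_refl, if_true, he, add_right_comm]
      · rw [if_neg (by omega), show m.val + p + 2 = m.val + 2 + p by omega,
          show m.val + p + 1 + 2 = m.val + 2 + p + 1 by omega]
  rw [← h3]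
  by_cases h0 : stripWeight B c (mergeGap m e) = 0
  · simp [h0]
  -- The type 2 relation asks that the symbols just below and just above the strand be compatible;
  -- the nonvanishing strip supplies this.
  have h4 := hB.not_forb_of_ne_zero hn h0 hmn
  rw [gap_mergeGap _ _ hmn, if_pos le_rfl] at h4
  have h5 : Admissible forb e ↔ ¬ forb (gap e m.val) (gap e (m.val + 1)) := by
    refine ⟨fun h => h _ (by omega), fun h => ?_⟩
    rw [(eq_splitGap_iff m _ e _).2 ⟨rfl, he, rfl⟩]
    refine (hB.admissible_of_ne_zero h0).2.splitGap hsymm ?_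
    rwa [gap_mergeGap _ _ hmn, if_pos le_rfl]
  by_cases h6 : forb (gap e m.val) (gap e (m.val + 1))
  · rw [if_neg (fun h => h.2.2 h6), if_neg (fun h => h5.1 h.2 h6), mul_zero]
  · rw [if_pos ⟨he, h4, h6⟩, if_pos ⟨he, h5.2 h6⟩, mul_comm]

end TypeTwo

/-! ### Pulling a strand past a crossing -/

section TypeThree

variable {C : Type u} [Fintype C] {R : Type v} [CommRing R] {n : ℕ}

/-- The relation for a move of type 3 that pulls a crossing with weights `X` through a horizontal
strand. -/
def CrossesThrough (u : C → Rˣ) (X B : C → C → C → C → R) : Prop :=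
  ∀ a₀ a₁ a₂ b₀ b₁ b₂, ∑ k, (u k : R) * (X a₀ a₁ a₂ k * (B a₀ k b₀ b₁ * B k a₂ b₁ b₂)) =
    ∑ k, (u k : R) * (X b₀ k b₂ b₁ * (B a₀ a₁ b₀ k * B a₁ a₂ k b₂))

/-- Changing gap `m + 1` affects only the two strip crossings beside it. These and the crossing
weight `X` form the triangle of the move; all other factors are common to both sides. -/
theorem CrossesThrough.sum_setGap {u : C → Rˣ} {X B : C → C → C → C → R}
    (h : CrossesThrough u X B) (m : Fin (n + 1)) (c e : Fin (n + 2 + 1) → C) :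
    ∑ k, (u k : R) * (X (gap c m.val) (gap c (m.val + 1)) (gap c (m.val + 2)) k *
        stripWeight B (setGap m k c) e) =
      ∑ k, (u k : R) * (X (gap e m.val) k (gap e (m.val + 2)) (gap e (m.val + 1)) *
        stripWeight B c (setGap m k e)) := by
  have hm := m.isLt
  have hmn : m.val ≤ n := by omega
  have key : ∀ c' e' : Fin (n + 2 + 1) → C,
      (∀ p ≤ n + 2, p ≠ m.val + 1 → gap c' p = gap c p) →
      (∀ p ≤ n + 2, p ≠ m.val + 1 → gap e' p = gap e p) →
      stripWeight B c' e' =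
        (∏ p ∈ range m.val, B (gap c p) (gap c (p + 1)) (gap e p) (gap e (p + 1))) *
        (B (gap c m.val) (gap c' (m.val + 1)) (gap e m.val) (gap e' (m.val + 1)) *
          B (gap c' (m.val + 1)) (gap c (m.val + 2)) (gap e' (m.val + 1)) (gap e (m.val + 2))) *
        ∏ p ∈ range (n - m.val), B (gap c (m.val + 2 + p)) (gap c (m.val + 2 + p + 1))
          (gap e (m.val + 2 + p)) (gap e (m.val + 2 + p + 1)) := by
    intro c' e' hc he
    rw [stripWeight, prod_range_split hmn]
    congr 1
    · congr 1
      · refine prod_congr rfl fun p hp => ?_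
        rw [mem_range] at hp
        rw [hc _ (by omega) (by omega), hc _ (by omega) (by omega), he _ (by omega) (by omega),
          he _ (by omega) (by omega)]
      · simp [prod_range_succ, add_assoc, hc m.val (by omega) (by omega),
          hc (m.val + 2) (by omega) (by omega), he m.val (by omega) (by omega),
          he (m.val + 2) (by omega) (by omega)]
    · refine prod_congr rfl fun p hp => ?_
      rw [mem_range] at hp
      rw [hc _ (by omega) (by omega), hc _ (by omega) (by omega), he _ (by omega) (by omega),
        he _ (by omega) (by omega)]
  have hset : ∀ (k : C) (c : Fin (n + 2 + 1) → C), ∀ p ≤ n + 2, p ≠ m.val + 1 →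
      gap (setGap m k c) p = gap c p := fun k c p hp hpm => by
    rw [gap_setGap _ _ _ hp, if_neg hpm]
  have hset' : ∀ (k : C) (c : Fin (n + 2 + 1) → C), gap (setGap m k c) (m.val + 1) = k :=
    fun k c => by rw [gap_setGap _ _ _ (by omega), if_pos rfl]
  simp only [key _ _ (hset _ c) (fun _ _ _ => rfl), key c _ (fun _ _ _ => rfl) (hset _ e), hset']
  have := congrArg (fun z : R =>
    (∏ p ∈ range m.val, B (gap c p) (gap c (p + 1)) (gap e p) (gap e (p + 1))) * z *
      ∏ p ∈ range (n - m.val), B (gap c (m.val + 2 + p)) (gap c (m.val + 2 + p + 1))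
          (gap e (m.val + 2 + p)) (gap e (m.val + 2 + p + 1)))
    (h (gap c m.val) (gap c (m.val + 1)) (gap c (m.val + 2)) (gap e m.val) (gap e (m.val + 1))
      (gap e (m.val + 2)))
  simp only [mul_sum, sum_mul] at this
  convert this using 2 <;> ring

end TypeThree

/-! ### The Reidemeister relations for a horizontal strand -/

section Strand

variable {C : Type u} {R : Type v} [CommRing R] (V : StateVariables C R)

theorem StateVariables.cross_not (b : Bool) (w s e n : C) :
    V.cross (!b) w s e n = V.cross b n w s e := by
  cases b <;> simp [StateVariables.cross, V.X_half_turn n w s e]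

theorem StateVariables.cross_half_turn (b : Bool) (w s e n : C) :
    V.cross b e n w s = V.cross b w s e n := by
  cases b <;> simp [StateVariables.cross, V.X_half_turn e n w s, V.X_half_turn n w s e]

theorem StateVariables.cross_eq_zero (b : Bool) (w s e n : C)
    (h : V.forbidden w s ∨ V.forbidden s e ∨ V.forbidden e n ∨ V.forbidden n w) :
    V.cross b w s e n = 0 := by
  cases b <;> simp only [StateVariables.cross, if_true, Bool.false_eq_true, if_false] <;>
    apply V.X_forbidden <;> tauto

/-- The weight of a crossing of a horizontal strand, which is the overpass if `b = true`, with a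
vertical strand. -/
def StateVariables.strand (b : Bool) (a a' p p' : C) : R := V.cross b p a a' p'

theorem StateVariables.strand_vanishesOn (b : Bool) : VanishesOn V.forbidden (V.strand b) := by
  intro a a' p p' h
  have h1 := V.forbidden_symm a p
  have h2 := V.forbidden_symm p p'
  refine V.cross_eq_zero b _ _ _ _ ?_
  tauto

variable {V} [Fintype C] (hV : V.ReidemeisterRelations) {u : C → Rˣ} (hu : ∀ i, (u i : R) = V.x i)
include hV hu

/-- In the forbidden case, which the type 2 relations leave out when `s = n`, every summand already
vanishes. -/
theorem StateVariables.ReidemeisterRelations.sum_cross_mul_cross [DecidableEq C]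
    [DecidableRel V.forbidden] (b : Bool) (w e s n : C) :
    ∑ k, (u k : R) * (V.cross b w s e k * V.cross (!b) w k e n) =
      if s = n ∧ ¬ V.forbidden s w ∧ ¬ V.forbidden s e then (↑(u s)⁻¹ : R) else 0 := by
  simp only [hu]
  split_ifs with h
  · obtain ⟨rfl, h1, h2⟩ := h
    have := hV.type_two_eq b w e s h1 h2
    rw [← hu s] at this
    exact (Units.inv_eq_of_mul_eq_one_right this).symm
  · rcases eq_or_ne s n with rfl | h1
    · refine sum_eq_zero fun k _ => ?_
      rw [V.cross_eq_zero b w s e k, zero_mul, mul_zero]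
      have := V.forbidden_symm s w
      tauto
    · exact hV.type_two_ne b w e s n h1

/-- The type 2 picture is turned by a right angle, which exchanges the flags `b` and `!b`. -/
theorem StateVariables.ReidemeisterRelations.pullsThrough (b : Bool) :
    PullsThrough V.forbidden u (V.strand b) := by
  classical
  intro a p q r
  have := hV.sum_cross_mul_cross hu (!b) q a p r
  simp only [Bool.not_not, V.cross_not] at this
  simp only [StateVariables.strand]
  have h1 : V.forbidden a p ↔ V.forbidden p a := ⟨V.forbidden_symm _ _, V.forbidden_symm _ _⟩
  refine (sum_congr rfl fun k _ => ?_).trans (this.trans (if_congr (by tauto) rfl rfl))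
  rw [V.cross_half_turn b k q p a]

theorem StateVariables.ReidemeisterRelations.pullsThrough_flip (b : Bool) :
    PullsThrough V.forbidden u (fun a a' p p' => V.strand b p p' a a') := by
  classical
  intro a p q r
  have := hV.sum_cross_mul_cross hu b a q p r
  simp only [V.cross_not] at this
  simp only [StateVariables.strand]
  have h1 : V.forbidden a p ↔ V.forbidden p a := ⟨V.forbidden_symm _ _, V.forbidden_symm _ _⟩
  rw [h1, ← this]
  refine sum_congr rfl fun k _ => ?_
  have h2 : V.cross b k q r a = V.cross b r a k q := by
    exact V.cross_half_turn b r a k q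
  rw [h2]

theorem StateVariables.ReidemeisterRelations.crossesThrough (b b' : Bool) :
    CrossesThrough u (V.cross b') (V.strand b) := by
  intro a₀ a₁ a₂ b₀ b₁ b₂
  -- The horizontal strand is strand `a`. It lies over both other strands or under both, so the
  -- three can be ordered by height for any `b'`.
  have := hV.type_three b b b' (fun _ => rfl) b₀ a₀ a₁ a₂ b₁ b₂
  simp only [hu, StateVariables.strand]
  rw [show (∑ k, V.x k * (V.cross b' b₀ k b₂ b₁ * (V.cross b b₀ a₀ a₁ k * V.cross b k a₁ a₂ b₂))) =
    ∑ k, V.x k * (V.cross b b₀ a₀ a₁ k * V.cross b k a₁ a₂ b₂ * V.cross b' b₀ k b₂ b₁) from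
    sum_congr rfl fun k _ => by ring, this]
  exact sum_congr rfl fun k _ => by ring

end Strand

/-! ### Transfer weights of the elementary pieces -/

section Transfer

theorem sum_eq_sum_section {α β M : Type*} [Fintype α] [Fintype β] [AddCommMonoid M]
    (φ : β → α) (ψ : α → β) (hψ : ∀ b, ψ (φ b) = b) (F : α → M)
    (hF : ∀ a, F a ≠ 0 → a = φ (ψ a)) : ∑ a, F a = ∑ b, F (φ b) := by
  refine (Finset.sum_of_injOn φ (fun a _ b _ h => ?_) (fun _ _ => mem_coe.2 (mem_univ _))
    (fun a _ ha => ?_) fun _ _ => rfl).symm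
  · rw [← hψ a, h, hψ]
  · by_contra h
    exact ha ⟨ψ a, mem_coe.2 (mem_univ _), (hF a h).symm⟩

/-- Cells cancel against joints: each gap but one belongs to exactly one joint of the piece, and the
exception is the gap that begins or ends there. -/
theorem prod_mul_prod_ite_inv {α β G : Type*} [Fintype α] [Fintype β] [CommGroup G]
    (r : α → β → Prop) [DecidableRel r] (f : β → G) (b₀ : β) (h₀ : ∀ a, ¬ r a b₀)
    (h : ∀ b, b ≠ b₀ → ∃! a, r a b) :
    (∏ b, f b) * ∏ a, ∏ b, (if r a b then (f b)⁻¹ else 1) = f b₀ := by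
  rw [prod_comm, ← prod_mul_distrib, Fintype.prod_eq_single b₀]
  · simp [h₀]
  · intro b hb
    obtain ⟨a, ha, ha'⟩ := h b hb
    rw [Fintype.prod_eq_single a, if_pos ha, mul_inv_cancel]
    exact fun a' h' => if_neg fun h'' => h' (ha' _ h'')

variable {C : Type u} {R : Type v} [CommRing R] {n n' : ℕ}

/-- The product of the facial variables of all gaps. -/
def layerWeight (u : C → Rˣ) (c : Fin (n + 1) → C) : Rˣ := ∏ p, u (c p)

theorem layerWeight_eq (u : C → Rˣ) (c : Fin (n + 1) → C) :
    layerWeight u c = ∏ p ∈ range (n + 1), u (gap c p) := by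
  rw [← Fin.prod_univ_eq_prod_range]
  simp [layerWeight, gap_val]

/-- The two extra gaps are the new one and a second copy of gap `m`. -/
theorem layerWeight_splitGap (u : C → Rˣ) (m : Fin (n + 1)) (k : C) (c : Fin (n + 1) → C) :
    layerWeight u (splitGap m k c) = u k * u (gap c m.val) * layerWeight u c := by
  have hm := m.isLt
  rw [layerWeight_eq, layerWeight_eq, show n + 2 + 1 = n + 1 + 2 by omega,
    prod_range_split (m := m.val + 1) (by omega : m.val + 1 ≤ n + 1)]
  have h0 := prod_range_split (j := 0) (m := m.val + 1) (by omega : m.val + 1 ≤ n + 1)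
    (fun p => u (gap c p))
  simp only [add_zero, range_zero, prod_empty, mul_one] at h0
  rw [h0, ← mul_assoc, mul_comm (u k * _)]
  congr 1
  · congr 1
    · refine prod_congr rfl fun p hp => ?_
      rw [mem_range] at hp
      rw [gap_splitGap, if_pos (by omega)]
    · simp [prod_range_succ, gap_splitGap, add_assoc]
  · refine prod_congr rfl fun p hp => ?_
    rw [gap_splitGap, if_neg (by omega), if_neg (by omega),
      show m.val + 1 + 2 + p - 2 = m.val + 1 + p by omega]

/-- The symbols below and above a piece agree on each face. -/
def Piece.Compatible (P : Piece n n') (c : Fin (n + 1) → C) (d : Fin (n' + 1) → C) : Prop :=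
  ∀ p q, P.Meets p q → c p = d q

open Classical in
/-- The inverse of the product of the facial variables of the joints of a piece. -/
noncomputable def Piece.jointWeight (P : Piece n n') (u : C → Rˣ) (d : Fin (n' + 1) → C) : Rˣ :=
  ∏ p, ∏ q, if P.Meets p q then (u (d q))⁻¹ else 1

open Classical in
/-- The contribution of a piece to the state sum. -/
noncomputable def Piece.weight (V : StateVariables C R) (u : C → Rˣ) (P : Piece n n')
    (c : Fin (n + 1) → C) (d : Fin (n' + 1) → C) : R :=
  if P.Compatible c d ∧ Admissible V.forbidden c ∧ Admissible V.forbidden d then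
    (P.jointWeight u d : R) * P.factor V c d else 0

theorem Piece.compatible_cup (m : Fin (n + 1)) (c : Fin (n + 1) → C) (d : Fin (n + 2 + 1) → C) :
    (Piece.cup m).Compatible c d ↔ d = splitGap m (gap d (m.val + 1)) c := by
  have hm := m.isLt
  constructor
  · intro h
    refine ext_gap fun q hq => ?_
    rw [gap_splitGap]
    split_ifs with h1 h2
    · rw [gap_of_le _ hq, gap_of_le c (by omega)]
      exact (h _ _ (Or.inl ⟨h1, rfl⟩)).symm
    · rw [h2]
    · rw [gap_of_le _ hq, gap_of_le c (by omega)]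
      refine (h _ _ (Or.inr ⟨?_, ?_⟩)).symm
      · change m.val + 2 ≤ q; omega
      · change q = q - 2 + 2; omega
  · intro h p q hpq
    rw [← gap_val d, h, gap_splitGap, ← gap_val c]
    rcases hpq with ⟨h1, h2⟩ | ⟨h1, h2⟩
    · rw [if_pos h1, h2]
    · rw [if_neg (by omega), if_neg (by omega), h2, Nat.add_sub_cancel]

theorem Piece.compatible_cap (m : Fin (n + 1)) (c : Fin (n + 2 + 1) → C) (d : Fin (n + 1) → C) :
    (Piece.cap m).Compatible c d ↔ c = splitGap m (gap c (m.val + 1)) d := by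
  rw [← Piece.compatible_cup]
  exact ⟨fun h p q hpq => (h q p hpq).symm, fun h p q hpq => (h q p hpq).symm⟩

theorem Piece.compatible_crossing (m : Fin (n + 1)) (b : Bool) (c d : Fin (n + 2 + 1) → C) :
    (Piece.crossing m b).Compatible c d ↔ d = setGap m (gap d (m.val + 1)) c := by
  have hm := m.isLt
  constructor
  · intro h
    refine ext_gap fun q hq => ?_
    rw [gap_setGap _ _ _ hq]
    split_ifs with h1
    · rw [h1]
    · rw [gap_of_le _ hq, gap_of_le _ hq]
      exact (h _ _ ⟨rfl, h1⟩).symm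
  · intro h p q hpq
    rw [← gap_val d, h, gap_setGap _ _ _ (by omega), ← hpq.1, if_neg hpq.2, gap_val]

theorem Piece.layerWeight_mul_jointWeight_cup (u : C → Rˣ) (m : Fin (n + 1))
    (d : Fin (n + 2 + 1) → C) :
    layerWeight u d * (Piece.cup m).jointWeight u d = u (gap d (m.val + 1)) := by
  classical
  have hm := m.isLt
  rw [gap_of_le _ (by omega), layerWeight, Piece.jointWeight]
  refine prod_mul_prod_ite_inv _ (fun q => u (d q)) _ (fun p => ?_) fun q hq => ?_
  · simp only [Piece.Meets]; omega
  · have hq' : q.val ≠ m.val + 1 := fun h => hq (Fin.ext h)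
    refine ⟨⟨if q.val ≤ m.val then q.val else q.val - 2, by split_ifs <;> omega⟩, ?_, ?_⟩
    · simp only [Piece.Meets]; split_ifs <;> omega
    · intro p hp
      refine Fin.ext ?_
      change p.val = if _ then _ else _
      rcases hp with ⟨h1, h2⟩ | ⟨h1, h2⟩
      · rw [if_pos h1, h2]
      · rw [if_neg (by omega)]; omega

theorem Piece.layerWeight_mul_jointWeight_cap (u : C → Rˣ) (m : Fin (n + 1))
    {c : Fin (n + 2 + 1) → C} {d : Fin (n + 1) → C} (h : (Piece.cap m).Compatible c d) :
    layerWeight u c * (Piece.cap m).jointWeight u d = u (gap c (m.val + 1)) := by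
  classical
  rw [← Piece.layerWeight_mul_jointWeight_cup u m c, Piece.jointWeight, Piece.jointWeight, prod_comm]
  congr 1
  refine prod_congr rfl fun q _ => prod_congr rfl fun p _ => if_ctx_congr Iff.rfl (fun hpq => ?_)
    fun _ => rfl
  rw [h p q hpq]

theorem Piece.layerWeight_mul_jointWeight_crossing (u : C → Rˣ) (m : Fin (n + 1)) (b : Bool)
    (d : Fin (n + 2 + 1) → C) :
    layerWeight u d * (Piece.crossing m b).jointWeight u d = u (gap d (m.val + 1)) := by
  classical
  have hm := m.isLt
  rw [gap_of_le _ (by omega), layerWeight, Piece.jointWeight]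
  refine prod_mul_prod_ite_inv _ (fun q => u (d q)) _ (fun p => ?_) fun q hq => ?_
  · simp only [Piece.Meets]; omega
  · have hq' : q.val ≠ m.val + 1 := fun h => hq (Fin.ext h)
    refine ⟨q, ⟨rfl, hq'⟩, fun p hp => Fin.ext hp.1⟩

theorem Piece.layerWeight_mul_jointWeight_crossing_lower (u : C → Rˣ) (m : Fin (n + 1)) (b : Bool)
    {c d : Fin (n + 2 + 1) → C} (h : (Piece.crossing m b).Compatible c d) :
    layerWeight u c * (Piece.crossing m b).jointWeight u d = u (gap c (m.val + 1)) := by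
  classical
  have hm := m.isLt
  rw [← Piece.layerWeight_mul_jointWeight_crossing u m b c]
  congr 1
  refine prod_congr rfl fun q _ => prod_congr rfl fun p _ => if_ctx_congr Iff.rfl (fun hpq => ?_)
    fun _ => rfl
  rw [← h q p hpq, Fin.ext hpq.1]

variable [Fintype C] (V : StateVariables C R) (u : C → Rˣ)

-- Summation over intermediate layers reduces to the symbol `k` of the digon on one side and to a
-- single layer on the other. Admissibility comes for free wherever the strip does not vanish.
open Classical in
theorem PullsThrough.sum_eq_sum {forb : C → C → Prop} {u : C → Rˣ}
    {B : C → C → C → C → R} (hsymm : ∀ i j, forb i j → forb j i) (hB : VanishesOn forb B)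
    (h : PullsThrough forb u B) (hn : n ≠ 0) (m : Fin (n + 1)) (c : Fin (n + 1) → C)
    (e : Fin (n + 2 + 1) → C) :
    ∑ d : Fin (n + 2 + 1) → C, (if d = splitGap m (gap d (m.val + 1)) c ∧ Admissible forb c ∧
        Admissible forb d then (u (gap d (m.val + 1)) : R) else 0) * stripWeight B d e =
      ∑ d : Fin (n + 1) → C, stripWeight B c d * (if e = splitGap m (gap e (m.val + 1)) d ∧
        Admissible forb d ∧ Admissible forb e then (↑(u (gap d m.val))⁻¹ : R) else 0) := by
  have hm := m.isLt
  have hset : ∀ k, gap (splitGap m k c) (m.val + 1) = k := fun k => by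
    rw [gap_splitGap, if_neg (by omega), if_pos rfl]
  rw [sum_eq_sum_section (fun k => splitGap m k c) (fun d => gap d (m.val + 1)) hset]
  swap
  · intro d hd
    by_contra h1
    exact hd (by rw [if_neg fun h2 => h1 h2.1, zero_mul])
  rw [Fintype.sum_eq_single (mergeGap m e)]
  swap
  · intro d hd
    rw [if_neg, mul_zero]
    exact fun h1 => hd ((eq_splitGap_iff m d e _).1 h1.1).2.2
  refine Eq.trans (sum_congr rfl fun k _ => ?_) ((h.sum_splitGap hsymm hB hn m c e).trans ?_)
  · rw [hset]
    by_cases h0 : stripWeight B (splitGap m k c) e = 0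
    · rw [h0, mul_zero, mul_zero]
    · have h1 := (hB.admissible_of_ne_zero h0).1
      rw [if_pos ⟨rfl, h1.of_splitGap, h1⟩]
  · by_cases h1 : gap e m.val = gap e (m.val + 2)
    · have h2 := (eq_splitGap_iff m (mergeGap m e) e _).2 ⟨rfl, h1, rfl⟩
      have h3 : Admissible forb e → Admissible forb (mergeGap m e) := fun h => by
        rw [h2] at h; exact h.of_splitGap
      rw [gap_mergeGap _ _ (by omega), if_pos le_rfl, mul_ite, mul_zero, mul_comm]
      refine if_congr ?_ rfl rfl
      tauto
    · rw [if_neg fun h => h1 h.1, if_neg, mul_zero]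
      exact fun h2 => h1 ((eq_splitGap_iff m _ e _).1 h2.1).2.1

open Classical in
theorem CrossesThrough.sum_eq_sum {forb : C → C → Prop} {u : C → Rˣ}
    {X B : C → C → C → C → R} (hsymm : ∀ i j, forb i j → forb j i) (hB : VanishesOn forb B)
    (hX : ∀ w s e n, forb w s ∨ forb s e ∨ forb e n ∨ forb n w → X w s e n = 0)
    (h : CrossesThrough u X B) (m : Fin (n + 1)) (c e : Fin (n + 2 + 1) → C) :
    ∑ d : Fin (n + 2 + 1) → C, (if d = setGap m (gap d (m.val + 1)) c ∧ Admissible forb c ∧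
        Admissible forb d then (u (gap d (m.val + 1)) : R) * X (gap c m.val) (gap c (m.val + 1))
          (gap c (m.val + 2)) (gap d (m.val + 1)) else 0) * stripWeight B d e =
      ∑ d : Fin (n + 2 + 1) → C, stripWeight B c d * (if e = setGap m (gap e (m.val + 1)) d ∧
        Admissible forb d ∧ Admissible forb e then (u (gap d (m.val + 1)) : R) *
          X (gap d m.val) (gap d (m.val + 1)) (gap d (m.val + 2)) (gap e (m.val + 1)) else 0) := by
  have hm := m.isLt
  have hset : ∀ (c : Fin (n + 2 + 1) → C) k, gap (setGap m k c) (m.val + 1) = k := fun c k => by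
    rw [gap_setGap _ _ _ (by omega), if_pos rfl]
  have hset' : ∀ (c : Fin (n + 2 + 1) → C) k p, p ≤ n + 2 → p ≠ m.val + 1 →
      gap (setGap m k c) p = gap c p := fun c k p hp hpm => by
    rw [gap_setGap _ _ _ hp, if_neg hpm]
  -- The strip controls only the intermediate layer; the two pairs at gap `m + 1` of the outer layer
  -- are controlled by `X`.
  have hadm : ∀ (c : Fin (n + 2 + 1) → C) k, Admissible forb (setGap m k c) →
      ¬ forb (gap c m.val) (gap c (m.val + 1)) →
      ¬ forb (gap c (m.val + 1)) (gap c (m.val + 2)) → Admissible forb c := by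
    intro c k h0 h1 h2 p hp
    rcases eq_or_ne p m.val with rfl | h3
    · exact h1
    rcases eq_or_ne p (m.val + 1) with rfl | h4
    · exact h2
    have := h0 p hp
    rwa [hset' _ _ _ (by omega) (by omega), hset' _ _ _ (by omega) (by omega)] at this
  have hback : ∀ (c : Fin (n + 2 + 1) → C) k, setGap m (gap c (m.val + 1)) (setGap m k c) = c := by
    intro c k
    refine ext_gap fun p hp => ?_
    rw [gap_setGap _ _ _ hp]
    split_ifs with h1
    · rw [h1]
    · rw [hset' _ _ _ hp h1]
  rw [sum_eq_sum_section (fun k => setGap m k c) (fun d => gap d (m.val + 1)) (hset c),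
    sum_eq_sum_section (fun k => setGap m k e) (fun d => gap d (m.val + 1)) (hset e)]
  rotate_left
  · intro d hd
    have h1 : e = setGap m (gap e (m.val + 1)) d := by
      by_contra h1
      exact hd (by rw [if_neg fun h2 => h1 h2.1, mul_zero])
    have h2 := hback d (gap e (m.val + 1))
    rw [← h1] at h2
    exact h2.symm
  · intro d hd
    by_contra h1
    exact hd (by rw [if_neg fun h2 => h1 h2.1, zero_mul])
  refine Eq.trans (sum_congr rfl fun k _ => ?_) ((h.sum_setGap m c e).trans
    (sum_congr rfl fun k _ => ?_))
  · rw [hset]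
    by_cases h0 : stripWeight B (setGap m k c) e = 0
    · rw [h0, mul_zero, mul_zero, mul_zero]
    by_cases h1 : X (gap c m.val) (gap c (m.val + 1)) (gap c (m.val + 2)) k = 0
    · simp [h1]
    have h2 := (hB.admissible_of_ne_zero h0).1
    have h3 := mt (hX _ _ _ _) h1
    rw [if_pos ⟨rfl, hadm c k h2 (by tauto) (by tauto), h2⟩, mul_assoc]
  · rw [hset, hset' _ _ _ (by omega) (by omega), hset' _ _ _ (by omega) (by omega)]
    by_cases h0 : stripWeight B c (setGap m k e) = 0
    · rw [h0, zero_mul, mul_zero, mul_zero]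
    by_cases h1 : X (gap e m.val) k (gap e (m.val + 2)) (gap e (m.val + 1)) = 0
    · simp [h1]
    have h2 := (hB.admissible_of_ne_zero h0).2
    have h3 := mt (hX _ _ _ _) h1
    have h4 : Admissible forb e := hadm e k h2
      (fun hf => h3 (Or.inr (Or.inr (Or.inr (hsymm _ _ hf)))))
      (fun hf => h3 (Or.inr (Or.inr (Or.inl (hsymm _ _ hf)))))
    rw [if_pos ⟨(hback e k).symm, h2, h4⟩]
    ring


omit [Fintype C] in
open Classical in
theorem Piece.weight_cup_mul (m : Fin (n + 1)) (c : Fin (n + 1) → C) (d : Fin (n + 2 + 1) → C) :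
    (Piece.cup m).weight V u c d * layerWeight u d =
      if d = splitGap m (gap d (m.val + 1)) c ∧ Admissible V.forbidden c ∧
        Admissible V.forbidden d then (u (gap d (m.val + 1)) : R) else 0 := by
  rw [Piece.weight, Piece.compatible_cup]
  split_ifs with h
  · rw [Piece.factor, mul_one, mul_comm, ← Units.val_mul, Piece.layerWeight_mul_jointWeight_cup]
  · rw [zero_mul]

-- Gap `m` below a minimum lies on two joints, so one inverse facial variable survives. This is the
-- inverse in the type 2 relation.
omit [Fintype C] in
open Classical in
theorem Piece.mul_weight_cup (m : Fin (n + 1)) (c : Fin (n + 1) → C) (d : Fin (n + 2 + 1) → C) :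
    layerWeight u c * (Piece.cup m).weight V u c d =
      if d = splitGap m (gap d (m.val + 1)) c ∧ Admissible V.forbidden c ∧
        Admissible V.forbidden d then (↑(u (gap c m.val))⁻¹ : R) else 0 := by
  rw [Piece.weight, Piece.compatible_cup]
  split_ifs with h
  · rw [Piece.factor, mul_one, ← Units.val_mul, Units.val_inj]
    have h1 := layerWeight_splitGap u m (gap d (m.val + 1)) c
    have h2 := Piece.layerWeight_mul_jointWeight_cup u m d
    rw [← h.1] at h1
    rw [h1, mul_assoc, mul_assoc, mul_eq_left] at h2
    exact eq_inv_of_mul_eq_one_right h2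
  · rw [mul_zero]

omit [Fintype C] in
open Classical in
theorem Piece.mul_weight_cap (m : Fin (n + 1)) (c : Fin (n + 2 + 1) → C) (d : Fin (n + 1) → C) :
    layerWeight u c * (Piece.cap m).weight V u c d =
      if c = splitGap m (gap c (m.val + 1)) d ∧ Admissible V.forbidden d ∧
        Admissible V.forbidden c then (u (gap c (m.val + 1)) : R) else 0 := by
  rw [Piece.weight, Piece.compatible_cap]
  simp only [and_comm (a := Admissible V.forbidden c)]
  split_ifs with h
  · rw [Piece.factor, mul_one, ← Units.val_mul, Piece.layerWeight_mul_jointWeight_cap]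
    exact (Piece.compatible_cap m c d).2 h.1
  · rw [mul_zero]

omit [Fintype C] in
open Classical in
theorem Piece.weight_cap_mul (m : Fin (n + 1)) (c : Fin (n + 2 + 1) → C) (d : Fin (n + 1) → C) :
    (Piece.cap m).weight V u c d * layerWeight u d =
      if c = splitGap m (gap c (m.val + 1)) d ∧ Admissible V.forbidden d ∧
        Admissible V.forbidden c then (↑(u (gap d m.val))⁻¹ : R) else 0 := by
  rw [Piece.weight, Piece.compatible_cap]
  simp only [and_comm (a := Admissible V.forbidden c)]
  split_ifs with h
  · rw [Piece.factor, mul_one, mul_comm, ← Units.val_mul, Units.val_inj]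
    have h1 := layerWeight_splitGap u m (gap c (m.val + 1)) d
    have h2 := Piece.layerWeight_mul_jointWeight_cap u m ((Piece.compatible_cap m c d).2 h.1)
    rw [← h.1] at h1
    rw [h1, mul_assoc, mul_assoc, mul_eq_left] at h2
    exact eq_inv_of_mul_eq_one_right h2
  · rw [zero_mul]

omit [Fintype C] in
open Classical in
theorem Piece.weight_crossing_mul (m : Fin (n + 1)) (b : Bool) (c d : Fin (n + 2 + 1) → C) :
    (Piece.crossing m b).weight V u c d * layerWeight u d =
      if d = setGap m (gap d (m.val + 1)) c ∧ Admissible V.forbidden c ∧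
        Admissible V.forbidden d then (u (gap d (m.val + 1)) : R) *
          V.cross b (gap c m.val) (gap c (m.val + 1)) (gap c (m.val + 2)) (gap d (m.val + 1))
      else 0 := by
  have hm := m.isLt
  rw [Piece.weight, Piece.compatible_crossing]
  split_ifs with h
  · rw [mul_right_comm, mul_comm (_ : R) (layerWeight u d : R), ← Units.val_mul,
      Piece.layerWeight_mul_jointWeight_crossing, Piece.factor, gap_of_le c (by omega),
      gap_of_le c (by omega), gap_of_le c (by omega), gap_of_le d (by omega)]
  · rw [zero_mul]

omit [Fintype C] in
open Classical in
theorem Piece.mul_weight_crossing (m : Fin (n + 1)) (b : Bool) (c d : Fin (n + 2 + 1) → C) :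
    layerWeight u c * (Piece.crossing m b).weight V u c d =
      if d = setGap m (gap d (m.val + 1)) c ∧ Admissible V.forbidden c ∧
        Admissible V.forbidden d then (u (gap c (m.val + 1)) : R) *
          V.cross b (gap c m.val) (gap c (m.val + 1)) (gap c (m.val + 2)) (gap d (m.val + 1))
      else 0 := by
  have hm := m.isLt
  rw [Piece.weight, Piece.compatible_crossing]
  split_ifs with h
  · rw [← mul_assoc, ← Units.val_mul, Piece.layerWeight_mul_jointWeight_crossing_lower,
      Piece.factor, gap_of_le c (by omega), gap_of_le c (by omega), gap_of_le c (by omega),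
      gap_of_le d (by omega)]
    exact (Piece.compatible_crossing m b c d).2 h.1
  · rw [mul_zero]

variable {V u}

/-- The layer between piece and strand is counted once on either side. This is the local step of the
pull. -/
theorem StateVariables.ReidemeisterRelations.sum_weight_strip
    (hV : V.ReidemeisterRelations) (hu : ∀ i, (u i : R) = V.x i) (b : Bool)
    (P : Piece n n') (hn : n ≠ 0) (hn' : n' ≠ 0) (c : Fin (n + 1) → C) (e : Fin (n' + 1) → C) :
    ∑ d, (P.weight V u c d * layerWeight u d) * stripWeight (V.strand b) d e =
      ∑ d, stripWeight (V.strand b) c d * (layerWeight u d * P.weight V u d e) := by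
  have hvan := V.strand_vanishesOn b
  cases P with
  | cup m =>
    simp only [Piece.weight_cup_mul, Piece.mul_weight_cup]
    exact (hV.pullsThrough hu b).sum_eq_sum V.forbidden_symm hvan hn m c e
  | cap m =>
    simp only [Piece.weight_cap_mul, Piece.mul_weight_cap]
    -- Reflection in a horizontal line turns a maximum into a minimum and exchanges the two sides of
    -- the identity.
    refine (sum_congr rfl fun _ _ => mul_comm _ _).trans (((hV.pullsThrough_flip hu b).sum_eq_sum
      V.forbidden_symm (hvan.flip V.forbidden_symm) hn' m e c).symm.trans
      (sum_congr rfl fun _ _ => mul_comm _ _))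
  | crossing m b' =>
    simp only [Piece.weight_crossing_mul, Piece.mul_weight_crossing]
    exact (hV.crossesThrough hu b b').sum_eq_sum V.forbidden_symm hvan (V.cross_eq_zero b') m c e

end Transfer

/-! ### Sums over paths as products of transfer matrices -/

section PathSum

variable {R : Type v} [CommRing R]

open Classical in
/-- The sum over all paths from `a` to `b` of the products of the weights of their steps. -/
noncomputable def pathSum {h : ℕ} {α : Fin (h + 1) → Type u} [∀ t, Fintype (α t)]
    (N : ∀ t : Fin h, α t.castSucc → α t.succ → R) (a : α 0) (b : α (Fin.last h)) : R :=
  ∑ τ : ∀ t, α t, if τ 0 = a ∧ τ (Fin.last h) = b then ∏ t, N t (τ t.castSucc) (τ t.succ) else 0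

open Classical in
theorem pathSum_zero {α : Fin 1 → Type u} [∀ t, Fintype (α t)]
    (N : ∀ t : Fin 0, α t.castSucc → α t.succ → R) (a b : α 0) :
    pathSum N a b = if a = b then 1 else 0 := by
  refine (Fintype.sum_eq_single ((Equiv.piUnique α).symm a) fun τ hτ =>
    if_neg fun h => hτ (funext fun t => ?_)).trans ?_
  · obtain rfl : t = 0 := Subsingleton.elim _ _
    exact h.1
  · simp only [univ_eq_empty, prod_empty]
    exact if_congr ⟨fun h => h.2, fun h => ⟨rfl, h⟩⟩ rfl rfl

theorem pathSum_succ {h : ℕ} {α : Fin (h + 1 + 1) → Type u} [∀ t, Fintype (α t)]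
    (N : ∀ t : Fin (h + 1), α t.castSucc → α t.succ → R) (a : α 0) (b : α (Fin.last (h + 1))) :
    pathSum N a b = ∑ d : α 1,
      N 0 a d * pathSum (α := fun t => α t.succ) (fun t => N t.succ) d b := by
  classical
  simp only [pathSum, mul_sum]
  rw [sum_comm, ← (Fin.consEquiv α).sum_comp, Fintype.sum_prod_type, Fintype.sum_eq_single a]
  · refine sum_congr rfl fun τ _ => ?_
    refine Eq.trans ?_ (Fintype.sum_eq_single (τ 0) fun d hd => ?_).symm
    · rw [mul_ite, mul_zero]
      refine if_ctx_congr ?_ (fun _ => ?_) fun _ => rfl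
      · exact ⟨fun h => ⟨rfl, h.2⟩, fun h => ⟨rfl, h.2⟩⟩
      · rw [Fin.prod_univ_succ]; rfl
    · rw [if_neg fun h => hd h.1.symm, mul_zero]
  · intro c hc
    exact sum_eq_zero fun τ _ => if_neg fun h => hc h.1

theorem sum_pathSum_mul {h : ℕ} {α : Fin (h + 1) → Type u} [∀ t, Fintype (α t)]
    {N K : ∀ t : Fin h, α t.castSucc → α t.succ → R} {S : ∀ t, α t → α t → R}
    (hS : ∀ t a b, ∑ d, N t a d * S t.succ d b = ∑ d, S t.castSucc a d * K t d b)
    (a : α 0) (b : α (Fin.last h)) :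
    ∑ d, pathSum N a d * S (Fin.last h) d b = ∑ d, S 0 a d * pathSum K d b := by
  classical
  induction h with
  | zero =>
    refine (Fintype.sum_eq_single (a : α (Fin.last 0)) fun d hd => ?_).trans
      (Eq.trans ?_ (Fintype.sum_eq_single (b : α 0) fun d hd => ?_).symm)
    · exact (congrArg (· * _) ((pathSum_zero N a d).trans (if_neg (Ne.symm hd)))).trans (zero_mul _)
    · exact (congrArg (· * S 0 a b) ((pathSum_zero N a a).trans (if_pos rfl))).trans
        ((mul_comm _ _).trans
          (congrArg (S 0 a b * ·) ((pathSum_zero K b b).trans (if_pos rfl))).symm)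
    · exact (congrArg (_ * ·) ((pathSum_zero K d b).trans (if_neg hd))).trans (mul_zero _)
  | succ h ih =>
    have ih' := fun d => ih (α := fun t => α t.succ) (N := fun t => N t.succ)
      (K := fun t => K t.succ) (S := fun t => S t.succ) (fun t => hS t.succ) d b
    simp only [pathSum_succ, sum_mul, mul_sum]
    rw [sum_comm]
    -- In the intermediate expression `S` sits just after the first step: the induction hypothesis
    -- has moved it there, and `hS 0` moves it past that step.
    refine Eq.trans (sum_congr rfl fun d _ => ?_) (Eq.trans (b := ∑ d : α 1, ∑ d' : α 1,
      N 0 a d' * S 1 d' d * pathSum (α := fun t => α t.succ) (fun t => K t.succ) d b) sum_comm ?_)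
    · have := congrArg (N 0 a d * ·) (ih' d)
      simp only [mul_sum, ← mul_assoc] at this
      exact this
    · rw [sum_comm (γ := α 0)]
      refine sum_congr rfl fun d _ => ?_
      have := congrArg (· * pathSum (α := fun t => α t.succ) (fun t => K t.succ) d b) (hS 0 a d)
      simp only [sum_mul, mul_assoc] at this
      simp only [mul_assoc]
      exact this

/-- Both sides weight each of the `h + 1` layers exactly once. -/
theorem mul_pathSum_comm {h : ℕ} {α : Fin (h + 1) → Type u} [∀ t, Fintype (α t)]
    (M : ∀ t : Fin h, α t.castSucc → α t.succ → R) (D : ∀ t, α t → R)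
    (a : α 0) (b : α (Fin.last h)) :
    D 0 a * pathSum (fun t c d => M t c d * D t.succ d) a b =
      pathSum (fun t c d => D t.castSucc c * M t c d) a b * D (Fin.last h) b := by
  classical
  simp only [pathSum, mul_sum, sum_mul]
  refine sum_congr rfl fun τ _ => ?_
  split_ifs with h1
  · obtain ⟨rfl, rfl⟩ := h1
    rw [prod_mul_distrib, prod_mul_distrib, mul_left_comm,
      ← Fin.prod_univ_succ (fun t => D t (τ t)), Fin.prod_univ_castSucc]
    ring
  · simp

end PathSum

/-! ### Faces and states in terms of layers -/

namespace LongLink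

variable {C : Type u} {R : Type v} [CommRing R] (T : LongLink)

theorem face_eq_of_meets {t : Fin T.height} {p : Fin (T.width t.castSucc + 1)}
    {q : Fin (T.width t.succ + 1)} (h : (T.piece t).Meets p q) :
    T.face t.castSucc p = T.face t.succ q :=
  Quot.sound ⟨⟨⟨t, p, q⟩, h⟩, rfl, rfl⟩

theorem _root_.FaceStateSum.Piece.meets_zero {n n' : ℕ} (P : Piece n n') : P.Meets 0 0 := by
  cases P <;> simp [Piece.Meets]

theorem _root_.FaceStateSum.Piece.meets_last {n n' : ℕ} (P : Piece n n') :
    P.Meets (Fin.last n) (Fin.last n') := by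
  cases P with
  | cup m => exact Or.inr ⟨by have := m.isLt; simp only [Fin.val_last]; omega, rfl⟩
  | cap m => exact Or.inr ⟨by have := m.isLt; simp only [Fin.val_last]; omega, rfl⟩
  | crossing m b => exact ⟨rfl, by have := m.isLt; simp only [Fin.val_last]; omega⟩

theorem _root_.FaceStateSum.Piece.Meets.mod_two {n n' : ℕ} {P : Piece n n'} {p : Fin (n + 1)}
    {q : Fin (n' + 1)} (h : P.Meets p q) : p.val % 2 = q.val % 2 := by
  cases P <;> simp only [Piece.Meets] at h <;> omega

theorem face_zero (t : Fin (T.height + 1)) : T.face t 0 = T.leftFace := by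
  induction t using Fin.induction with
  | zero => rfl
  | succ t ih => rw [← ih]; exact (T.face_eq_of_meets (T.piece t).meets_zero).symm

theorem face_last (t : Fin (T.height + 1)) : T.face t (Fin.last _) = T.rightFace := by
  induction t using Fin.induction with
  | zero => rfl
  | succ t ih => rw [← ih]; exact (T.face_eq_of_meets (T.piece t).meets_last).symm

/-- The parity of the gaps of a face. -/
def parity : T.Face → ℕ :=
  Quot.lift (fun c => c.2.val % 2) (by rintro _ _ ⟨J, rfl, rfl⟩; exact J.2.mod_two)

/-- Checkerboard colouring: pieces preserve the parity of gaps, and the bottom layer has gaps 0 and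
1. -/
theorem leftFace_ne_rightFace : T.leftFace ≠ T.rightFace := by
  intro h
  have h1 : (0 : ℕ) % 2 = T.width 0 % 2 := congrArg T.parity h
  rw [T.width_bottom] at h1
  omega

theorem width_mod_two (t : Fin (T.height + 1)) : T.width t % 2 = 1 := by
  induction t using Fin.induction with
  | zero => rw [T.width_bottom]
  | succ t ih => rw [← ih]; exact (T.piece t).meets_last.mod_two.symm

/-- The symbols of the gaps of all layers, for a state. -/
def layerColors (σ : T.Face → C) : ∀ t, Fin (T.width t + 1) → C := fun t p => σ (T.face t p)

/-- A colouring that agrees across every joint descends to the quotient of cells that defines the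
faces. -/
theorem eq_layerColors {τ : ∀ t, Fin (T.width t + 1) → C}
    (h : ∀ t, (T.piece t).Compatible (τ t.castSucc) (τ t.succ)) :
    τ = T.layerColors (fun F => τ (Quot.out F).1 (Quot.out F).2) := by
  let g : T.Face → C := Quot.lift (fun c => τ c.1 c.2)
    (by rintro _ _ ⟨J, rfl, rfl⟩; exact h _ _ _ J.2)
  have hg : ∀ F : T.Face, g F = τ (Quot.out F).1 (Quot.out F).2 := fun F => by
    conv_lhs => rw [← Quot.out_eq F]
  funext t p
  exact hg (T.face t p)

theorem layerColors_compatible (σ : T.Face → C) (t : Fin T.height) :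
    (T.piece t).Compatible (T.layerColors σ t.castSucc) (T.layerColors σ t.succ) :=
  fun _ _ h => congrArg σ (T.face_eq_of_meets h)

theorem not_forbidden_iff (V : StateVariables C R) (σ : T.Face → C) :
    ¬ T.Forbidden V σ ↔ ∀ t, Admissible V.forbidden (T.layerColors σ t) := by
  simp only [Forbidden, not_exists, Admissible]
  refine forall_congr' fun t => ⟨fun h p hp => ?_, fun h p => ?_⟩
  · rw [gap_of_le _ (by omega), gap_of_le _ (by omega)]
    exact h ⟨p, hp⟩
  · have := h p.val p.isLt
    rwa [gap_of_le _ (by omega), gap_of_le _ (by omega)] at this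

theorem prod_pow_card_fiber {α β G : Type*} [Fintype α] [Fintype β] [CommMonoid G]
    (f : α → β) (g : β → G) : ∏ b, g b ^ Nat.card {a // f a = b} = ∏ a, g (f a) := by
  classical
  rw [← prod_fiberwise' univ f g]
  refine prod_congr rfl fun b _ => ?_
  rw [prod_const, Nat.card_eq_fintype_card, Fintype.card_subtype]

/-- The definition of `eulerChar` makes the exponent additive over cells and joints, so the facial
part of the state sum localises. -/
theorem prod_zpow_eulerChar (u : C → Rˣ) (σ : T.Face → C) :
    ∏ F, u (σ F) ^ T.eulerChar F = (∏ t, layerWeight u (T.layerColors σ t)) *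
      ∏ t, (T.piece t).jointWeight u (T.layerColors σ t.succ) := by
  classical
  have h1 := prod_pow_card_fiber (fun c : T.Cell => T.face c.1 c.2) (fun F => u (σ F))
  have h2 := prod_pow_card_fiber (fun J : T.Joint => T.face J.lower.1 J.lower.2)
    (fun F => u (σ F))
  simp only [eulerChar, zpow_sub, zpow_natCast, prod_mul_distrib, prod_inv_distrib]
  rw [h1, h2, Fintype.prod_sigma]
  congr 1
  rw [← prod_inv_distrib]
  simp only [Piece.jointWeight]
  have h3 : ∀ J : T.Joint, (u (σ (T.face J.lower.1 J.lower.2)))⁻¹ =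
      (fun J : Σ t : Fin T.height, Fin (T.width t.castSucc + 1) × Fin (T.width t.succ + 1) =>
        (u (T.layerColors σ J.1.succ J.2.2))⁻¹) J.1 := fun J => by
    have := T.face_eq_of_meets J.2
    simp only [layerColors, ← this]; rfl
  rw [prod_congr rfl fun J _ => h3 J,
    ← prod_subtype (univ.filter fun J : Σ t : Fin T.height, Fin (T.width t.castSucc + 1) ×
        Fin (T.width t.succ + 1) => (T.piece J.1).Meets J.2.1 J.2.2) (by simp)
      (fun J => (u (T.layerColors σ J.1.succ J.2.2))⁻¹), prod_filter, Fintype.prod_sigma]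
  refine prod_congr rfl fun t _ => ?_
  rw [Fintype.prod_prod_type]

end LongLink

theorem intPow_units {R : Type v} [CommRing R] (a : Rˣ) (z : ℤ) :
    intPow (a : R) z = ((a ^ z : Rˣ) : R) := by
  cases z with
  | ofNat n => simp [intPow]
  | negSucc n => simp [intPow, zpow_negSucc]

/-! ### Colourings of the bottom and top layers -/

section EdgeColors

variable {C : Type u} {R : Type v} [CommRing R] {n : ℕ}

/-- Symbol `i` for the first gap and `j` for the others. -/
def edgeColors (n : ℕ) (i j : C) : Fin (n + 1) → C := fun p => if p.val = 0 then i else j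

theorem eq_edgeColors_iff (hn : n = 1) (c : Fin (n + 1) → C) (i j : C) :
    c = edgeColors n i j ↔ c 0 = i ∧ c (Fin.last n) = j := by
  subst hn
  constructor
  · rintro rfl
    exact ⟨rfl, rfl⟩
  · rintro ⟨rfl, rfl⟩
    funext p
    fin_cases p <;> rfl

theorem layerWeight_edgeColors (hn : n = 1) (u : C → Rˣ) (i j : C) :
    layerWeight u (edgeColors n i j) = u i * u j := by
  subst hn
  rw [layerWeight, Fin.prod_univ_two]; rfl

theorem stripWeight_edgeColors (hn : n = 1) (B : C → C → C → C → R) (i j k l : C) :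
    stripWeight B (edgeColors n i j) (edgeColors n k l) = B i j k l := by
  subst hn
  rw [stripWeight, prod_range_one]; rfl

theorem admissible_edgeColors (hn : n = 1) {forb : C → C → Prop} {i j : C} (h : ¬ forb i j) :
    Admissible forb (edgeColors n i j) := by
  subst hn
  intro p hp
  obtain rfl : p = 0 := by omega
  exact h

end EdgeColors

/-! ### The state sum as a diagonal transfer matrix -/

namespace LongLink

variable {C : Type u} [Fintype C] {R : Type v} [CommRing R] (T : LongLink)
  (V : StateVariables C R) (u : C → Rˣ)

/-- The weights of the steps of the state sum, in which a layer belongs to the piece below. -/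
noncomputable def lowerStep (t : Fin T.height) (c : Fin (T.width t.castSucc + 1) → C)
    (d : Fin (T.width t.succ + 1) → C) : R :=
  (T.piece t).weight V u c d * layerWeight u d

/-- The weights of the steps of the state sum, in which a layer belongs to the piece above. -/
noncomputable def upperStep (t : Fin T.height) (c : Fin (T.width t.castSucc + 1) → C)
    (d : Fin (T.width t.succ + 1) → C) : R :=
  layerWeight u c * (T.piece t).weight V u c d

/-- The state sum with symbols `i` and `j` at the bottom and `k` and `l` at the top. -/
noncomputable def boundaryValue (i j : C) (d : Fin (T.width (Fin.last T.height) + 1) → C) : R :=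
  pathSum (α := fun t => Fin (T.width t + 1) → C) (T.lowerStep V u)
    (edgeColors (T.width 0) i j) d

omit [Fintype C] in
theorem prod_weight_layerColors {σ : T.Face → C}
    (h : ∀ t, Admissible V.forbidden (T.layerColors σ t)) :
    ∏ t, (T.piece t).weight V u (T.layerColors σ t.castSucc) (T.layerColors σ t.succ) =
      ((∏ t, (T.piece t).jointWeight u (T.layerColors σ t.succ) : Rˣ) : R) *
        ∏ t, (T.piece t).factor V (T.layerColors σ t.castSucc) (T.layerColors σ t.succ) := by
  rw [Units.coe_prod, ← prod_mul_distrib]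
  exact prod_congr rfl fun t _ => if_pos ⟨T.layerColors_compatible σ t, h _, h _⟩

omit [Fintype C] in
theorem extends_twoFaces_iff (σ : T.Face → C) (i j : C) :
    Extends σ (twoFaces T.leftFace T.rightFace i j) ↔ σ T.leftFace = i ∧ σ T.rightFace = j := by
  constructor
  · exact fun h => ⟨h _ _ (Or.inl ⟨rfl, rfl⟩), h _ _ (Or.inr ⟨rfl, rfl⟩)⟩
  · rintro ⟨rfl, rfl⟩ F c (⟨rfl, rfl⟩ | ⟨rfl, rfl⟩) <;> rfl

-- The two infinite faces are distinct, so each lacks exactly one facial variable, and `u i * u j`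
-- restores both.
omit [Fintype C] in
open Classical in
theorem mul_prod_intPow {V : StateVariables C R} {u : C → Rˣ} (hu : ∀ i, (u i : R) = V.x i)
    {σ : T.Face → C} {i j : C} (hi : σ T.leftFace = i) (hj : σ T.rightFace = j) :
    ((u i * u j : Rˣ) : R) * ∏ F : T.Face, intPow (V.x (σ F))
        (if (twoFaces T.leftFace T.rightFace i j : T.PartialState C) F = ∅ then T.eulerChar F
          else T.eulerChar F - 1) =
      ((∏ F, u (σ F) ^ T.eulerChar F : Rˣ) : R) := by
  have h1 : ∀ F, (twoFaces T.leftFace T.rightFace i j : T.PartialState C) F = ∅ ↔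
      ¬ (F = T.leftFace ∨ F = T.rightFace) := fun F => by
    rw [Set.eq_empty_iff_forall_notMem]
    constructor
    · rintro h (rfl | rfl)
      · exact h i (Or.inl ⟨rfl, rfl⟩)
      · exact h j (Or.inr ⟨rfl, rfl⟩)
    · rintro h c (⟨rfl, -⟩ | ⟨rfl, -⟩)
      · exact h (Or.inl rfl)
      · exact h (Or.inr rfl)
  have h2 : ∀ F, (u (σ F) ^ T.eulerChar F : Rˣ) =
      (if F = T.leftFace then u i else 1) * (if F = T.rightFace then u j else 1) *
      u (σ F) ^ (if (twoFaces T.leftFace T.rightFace i j : T.PartialState C) F = ∅ then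
        T.eulerChar F else T.eulerChar F - 1) := fun F => by
    simp only [h1]
    rcases eq_or_ne F T.leftFace with rfl | hl
    · rw [if_pos rfl, if_neg T.leftFace_ne_rightFace, if_neg (by simp), mul_one, hi, ← zpow_one_add,
        add_sub_cancel]
    rcases eq_or_ne F T.rightFace with rfl | hr
    · rw [if_pos rfl, if_neg hl, if_neg (by simp), one_mul, hj, ← zpow_one_add, add_sub_cancel]
    · rw [if_neg hl, if_neg hr, if_pos (by tauto), one_mul, one_mul]
  simp only [h2, prod_mul_distrib, prod_ite_eq', mem_univ, if_true, Units.val_mul, Units.coe_prod,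
    ← hu, intPow_units]

variable {V u}

theorem value_eq_boundaryValue (hu : ∀ i, (u i : R) = V.x i) {i j : C} (hij : ¬ V.forbidden i j) :
    T.value V (twoFaces T.leftFace T.rightFace i j) =
      T.boundaryValue V u i j (edgeColors _ i j) := by
  classical
  have ha := admissible_edgeColors T.width_bottom hij
  -- The factor `u i * u j` is also the weight of the bottom layer, the only layer that `lowerStep`
  -- does not count.
  rw [← (u i * u j).isUnit.mul_right_inj, value, boundaryValue, pathSum, mul_sum, mul_sum]
  symm
  rw [sum_eq_sum_section T.layerColors (fun τ F => τ (Quot.out F).1 (Quot.out F).2)]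
  rotate_left
  · intro σ
    funext F
    exact congrArg σ (Quot.out_eq F)
  · intro τ hτ
    refine T.eq_layerColors fun t => ?_
    by_contra h
    refine hτ ?_
    split_ifs
    · rw [prod_eq_zero (mem_univ t), mul_zero]
      rw [lowerStep, Piece.weight, if_neg fun h1 => h h1.1, zero_mul]
    · rw [mul_zero]
  refine sum_congr rfl fun σ _ => ?_
  have h0 : T.layerColors σ 0 = edgeColors (T.width 0) i j ↔
      σ T.leftFace = i ∧ σ T.rightFace = j := eq_edgeColors_iff T.width_bottom _ i j
  have h1 : T.layerColors σ (Fin.last _) = edgeColors (T.width (Fin.last _)) i j ↔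
      σ T.leftFace = i ∧ σ T.rightFace = j := by
    rw [eq_edgeColors_iff T.width_top, layerColors, layerColors, face_zero, face_last]
  simp only [h0, h1, and_self, extends_twoFaces_iff, not_forbidden_iff]
  by_cases hs : σ T.leftFace = i ∧ σ T.rightFace = j
  swap
  · rw [if_neg hs, if_neg fun h => hs h.1]
  rw [if_pos hs]
  have h2 : ∏ t, T.lowerStep V u t (T.layerColors σ t.castSucc) (T.layerColors σ t.succ) =
      (∏ t, (T.piece t).weight V u (T.layerColors σ t.castSucc) (T.layerColors σ t.succ)) *
        ∏ t : Fin T.height, (layerWeight u (T.layerColors σ t.succ) : R) := prod_mul_distrib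
  by_cases hadm : ∀ t, Admissible V.forbidden (T.layerColors σ t)
  · rw [if_pos ⟨hs, hadm⟩, ← mul_assoc, T.mul_prod_intPow hu hs.1 hs.2, prod_zpow_eulerChar, h2,
      T.prod_weight_layerColors V u hadm, Fin.prod_univ_succ, h0.2 hs,
      layerWeight_edgeColors T.width_bottom]
    simp only [Units.val_mul, Units.coe_prod]
    change _ = _ * ∏ t, (T.piece t).factor V (T.layerColors σ t.castSucc) (T.layerColors σ t.succ)
    ring
  · rw [if_neg fun h => hadm h.2, h2]
    obtain ⟨t, ht⟩ := not_forall.1 hadm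
    -- The bottom layer is admissible by `hij`, so a bad layer lies on top of some piece, whose
    -- weight is then zero.
    obtain ⟨t, rfl⟩ : ∃ s, t = Fin.succ s := by
      refine Fin.exists_succ_eq.2 ?_ |>.imp fun _ h => h.symm
      rintro rfl
      rw [h0.2 hs] at ht
      exact ht ha
    rw [prod_eq_zero (i := t) (mem_univ t), zero_mul]
    exact if_neg fun h => ht h.2.2

/-- A path of nonzero weight comes from a state, and the outer gaps of the bottom and top layers lie
in the same two infinite faces. -/
theorem boundaryValue_eq_zero {i j : C} {d : Fin (T.width (Fin.last T.height) + 1) → C}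
    (hd : d ≠ edgeColors _ i j) : T.boundaryValue V u i j d = 0 := by
  classical
  refine sum_eq_zero fun τ _ => ?_
  split_ifs with h
  swap
  · rfl
  obtain ⟨h0, rfl⟩ := h
  by_cases hc : ∀ t, (T.piece t).Compatible (τ t.castSucc) (τ t.succ)
  · refine absurd ((eq_edgeColors_iff T.width_top _ i j).2 ?_) hd
    rw [← (eq_edgeColors_iff T.width_bottom _ i j).1 h0 |>.1,
      ← (eq_edgeColors_iff T.width_bottom _ i j).1 h0 |>.2]
    obtain ⟨σ, rfl⟩ : ∃ σ, τ = T.layerColors σ := ⟨_, T.eq_layerColors hc⟩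
    simp only [layerColors, face_zero, face_last, and_self]
  · obtain ⟨t, ht⟩ := not_forall.1 hc
    refine prod_eq_zero (mem_univ t) ?_
    rw [lowerStep, Piece.weight, if_neg fun h1 => ht h1.1, zero_mul]

theorem value_mul_strand (hV : V.ReidemeisterRelations) (hu : ∀ i, (u i : R) = V.x i) (b : Bool)
    (i j k l : C) :
    T.value V (twoFaces T.leftFace T.rightFace i j) * V.strand b i j k l =
      V.strand b i j k l * T.value V (twoFaces T.leftFace T.rightFace k l) := by
  by_cases hf : V.forbidden i j ∨ V.forbidden k l
  · rw [V.strand_vanishesOn b i j k l (by tauto), mul_zero, zero_mul]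
  rw [not_or] at hf
  -- Widths are odd, so the strand always has something to cross.
  have hn : ∀ t, T.width t ≠ 0 := fun t h => by
    have := T.width_mod_two t
    omega
  have key := sum_pathSum_mul (α := fun t => Fin (T.width t + 1) → C) (N := T.lowerStep V u)
    (K := T.upperStep V u) (S := fun _ => stripWeight (V.strand b))
    (fun t a b' => hV.sum_weight_strip hu b (T.piece t) (hn _) (hn _) a b')
    (edgeColors (T.width 0) i j) (edgeColors (T.width (Fin.last _)) k l)
  have hcomm : ∀ d, (layerWeight u d : R) * pathSum (α := fun t => Fin (T.width t + 1) → C)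
      (T.lowerStep V u) d (edgeColors (T.width (Fin.last _)) k l) =
      pathSum (α := fun t => Fin (T.width t + 1) → C)
      (T.upperStep V u) d (edgeColors (T.width (Fin.last _)) k l) *
        layerWeight u (edgeColors (T.width (Fin.last _)) k l) := fun d =>
    mul_pathSum_comm (α := fun t => Fin (T.width t + 1) → C)
      (fun t => (T.piece t).weight V u) (fun t c => (layerWeight u c : R)) d _
  rw [T.value_eq_boundaryValue hu hf.1, T.value_eq_boundaryValue hu hf.2]
  rw [Fintype.sum_eq_single (edgeColors (T.width (Fin.last _)) i j),
    Fintype.sum_eq_single (edgeColors (T.width 0) k l), stripWeight_edgeColors T.width_top,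
    stripWeight_edgeColors T.width_bottom] at key
  · refine key.trans (congrArg _ ?_)
    have := hcomm (edgeColors (T.width 0) k l)
    rw [layerWeight_edgeColors T.width_bottom, layerWeight_edgeColors T.width_top, mul_comm,
      (u k * u l).isUnit.mul_left_inj] at this
    exact this.symm
  · intro d hd
    have h0 : pathSum (α := fun t => Fin (T.width t + 1) → C) (T.lowerStep V u) d
        (edgeColors (T.width (Fin.last _)) k l) = 0 := by
      have hd' : d = edgeColors (T.width 0) (d 0) (d (Fin.last _)) :=
        (eq_edgeColors_iff T.width_bottom _ _ _).2 ⟨rfl, rfl⟩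
      rw [hd']
      refine T.boundaryValue_eq_zero fun h => hd ?_
      obtain ⟨h1, h2⟩ := (eq_edgeColors_iff T.width_top _ _ _).1 h
      obtain ⟨h3, h4⟩ := (eq_edgeColors_iff T.width_top _ k l).1 rfl
      exact (eq_edgeColors_iff T.width_bottom _ _ _).2 ⟨h1.symm.trans h3, h2.symm.trans h4⟩
    -- The path sums with `lowerStep` and `upperStep` differ by invertible end weights, so the
    -- second matrix is diagonal too.
    have := hcomm d
    rw [h0, mul_zero, eq_comm, (Units.isUnit _).mul_left_eq_zero] at this
    rw [this, mul_zero]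
  · intro d hd
    exact (congrArg (· * _) (T.boundaryValue_eq_zero hd)).trans (zero_mul _)

omit [Fintype C] in
theorem twoFaces_swap (f g : T.Face) (i j : C) :
    (twoFaces f g i j : T.PartialState C) = twoFaces g f j i :=
  funext fun _ => Set.ext fun _ => or_comm

end LongLink

end FaceStateSum

theorem mainTheorem6 {C : Type*} [Fintype C] {R : Type*} [CommRing R]
    (V : FaceStateSum.StateVariables C R) (hV : V.ReidemeisterRelations)
    (hne : ∀ i, ∃ j, ¬ V.forbidden i j)
    (T : FaceStateSum.LongLink) (f g : T.Face) (hfg : {f, g} = T.infiniteFaces)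
    (i j k l : C) (hinv : IsUnit (V.X i k l j) ∨ IsUnit (V.X j i k l)) :
    T.value V (FaceStateSum.LongLink.twoFaces f g i j) =
      T.value V (FaceStateSum.LongLink.twoFaces f g k l) := by
  have hu : ∀ i, ((hV.isUnit_x hne i).unit : R) = V.x i := fun i => IsUnit.unit_spec _
  have main : ∀ a b c d : C, (∃ β, IsUnit (V.strand β a b c d)) →
      T.value V (FaceStateSum.LongLink.twoFaces T.leftFace T.rightFace a b) =
        T.value V (FaceStateSum.LongLink.twoFaces T.leftFace T.rightFace c d) := by
    rintro a b c d ⟨β, h⟩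
    have := T.value_mul_strand hV hu β a b c d
    rwa [mul_comm, h.mul_right_inj] at this
  -- With `f` on the left, the strand has `k, l` below and `i, j` above; with `f` on the right, `j,
  -- i` below and `l, k` above. In both cases `X i k l j` belongs to the overpassing strand and `X j
  -- i k l` to the underpassing one, up to a half turn.
  rcases Set.pair_eq_pair_iff.1 hfg with ⟨rfl, rfl⟩ | ⟨rfl, rfl⟩
  · symm
    refine main k l i j ?_
    rcases hinv with h | h
    · exact ⟨true, (congrArg IsUnit (V.X_half_turn i k l j)).mpr h⟩
    · exact ⟨false, h⟩
  · rw [T.twoFaces_swap _ _ i j, T.twoFaces_swap _ _ k l]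
    refine main j i l k ?_
    rcases hinv with h | h
    · exact ⟨true, h⟩
    · exact ⟨false, (congrArg IsUnit (V.X_half_turn j i k l)).mpr h⟩
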